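/- Let $\mathbb D=\{z\in\mathbb C:|z|<1\}$ and let $\mathcal A$ be the set of functions $f$ analytic in $\mathbb D$ with $f(0)=0$ and $f'(0)=1$. Let \begin{itemize} \item $\mathcal S$ be the set of univalent (injective) $f\in\mathcal A$; \item $\mathcal S^\star$ be the set of $f\in\mathcal S$ for which $f(\mathbb D)$ is starlike with respect to the origin; \item $\mathcal S^\star(1/2)$ be the set of $f\in\mathcal A$ with $\operatorname{Re}\frac{zf'(z)}{f(z)}>\frac12$ for all $z\in\mathbb D$; \item $\mathcal U$ be the set of $f\in\mathcal A$ with $\left|\left(\frac{z}{f(z)}\right)^2f'(z)-1\right|<1$ for all $z\in\mathbb D$; \item $\mathcal G$ be the set of $f\in\mathcal A$ with $\operatorname{Re}\left\{1+\frac{zf''(z)}{f'(z)}\right\}<\frac32$ for all $z\in\mathbb D$. \end{itemize} These conditions include that the denominators do not vanish, except for the removable singularity of $z/f(z)$ and $zf'(z)/f(z)$ at $z=0$, where both take the value $1$. Put $$D(f;z)=2\frac{zf'(z)}{f(z)}-\frac{zf''(z)}{f'(z)}.$$ Then $D(f;z)$ is well defined (that is, $f(z)\neq0$ if $z\ne0$,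 and $f'(z)\neq0$) and $\operatorname{Re}D(f;z)>0$ for all $|z|<r_*$, in each of the following cases: \begin{itemize} \item[(i)] $f\in\mathcal U$ and $r_*=r_1=0.839\ldots$, the unique real root of $r^3+2r^2-2=0$; \item[(ii)] $f\in\mathcal S^\star(1/2)$ and $r_*=r_2=\sqrt{\frac{\sqrt5-1}{2}}$; \item[(iii)] $f\in\mathcal G$ and $r_*=r_3=\frac23$; \item[(iv)] $f\in\mathcal S^\star$ and $r_*=r_4=\frac12$; \item[(v)] $f\in\mathcal S$ and $r_*=r_5=\frac14$. \end{itemize} -/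

import Mathlib

open Metric

noncomputable section

namespace Univ

/-- The class `𝒜`: functions analytic in the open unit disk with `f(0) = 0`, `f'(0) = 1`. -/
def ClassA (f : ℂ → ℂ) : Prop :=
  AnalyticOnNhd ℂ f (ball 0 1) ∧ f 0 = 0 ∧ deriv f 0 = 1

/-- The class `𝒮`: univalent (injective) functions in `𝒜`. -/
def ClassS (f : ℂ → ℂ) : Prop :=
  ClassA f ∧ Set.InjOn f (ball 0 1)

/-- The class `𝒮*`: univalent functions in `𝒜` that map the unit disk onto
a domain that is starlike with respect to the origin. -/
def ClassStar (f : ℂ → ℂ) : Prop :=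
  ClassS f ∧ StarConvex ℝ 0 (f '' ball 0 1)

/-- The function `z f'(z) / f(z)`, for `f` in `𝒜`. Its singularity at the origin
is removable, with value `1`. -/
def logQuot (f : ℂ → ℂ) (z : ℂ) : ℂ :=
  if z = 0 then 1 else z * deriv f z / f z

/-- The class `𝒮*(α)` of starlike functions of order `α`:
`Re (z f'(z) / f(z)) > α` in the unit disk (so `f` has no zero but the origin). -/
def ClassStarOrder (α : ℝ) (f : ℂ → ℂ) : Prop :=
  ClassA f ∧ (∀ z ∈ ball (0 : ℂ) 1, z ≠ 0 → f z ≠ 0) ∧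
    ∀ z ∈ ball (0 : ℂ) 1, α < (logQuot f z).re

/-- The class `𝒰`: `|(z / f(z))² f'(z) - 1| < 1` in the unit disk. At the origin the
left side has the limit `0`, so the condition there is void. -/
def ClassU (f : ℂ → ℂ) : Prop :=
  ClassA f ∧ ∀ z ∈ ball (0 : ℂ) 1, z ≠ 0 →
    f z ≠ 0 ∧ ‖(z / f z) ^ 2 * deriv f z - 1‖ < 1

/-- The class `𝒢`: `Re (1 + z f''(z) / f'(z)) < 3 / 2` in the unit disk. -/
def ClassG (f : ℂ → ℂ) : Prop :=
  ClassA f ∧ ∀ z ∈ ball (0 : ℂ) 1,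
    deriv f z ≠ 0 ∧ (1 + z * deriv (deriv f) z / deriv f z).re < 3 / 2

/-- `D(f; z) = 2 z f'(z) / f(z) - z f''(z) / f'(z)`. -/
def D (f : ℂ → ℂ) (z : ℂ) : ℂ :=
  2 * logQuot f z - z * deriv (deriv f) z / deriv f z

/-- `D(f; z)` is well defined (no denominator vanishes, apart from the removable
singularity at the origin) and `Re D(f; z) > 0`, for all `|z| < r`. -/
def RePosOn (f : ℂ → ℂ) (r : ℝ) : Prop :=
  ∀ z : ℂ, ‖z‖ < r → (z ≠ 0 → f z ≠ 0) ∧ deriv f z ≠ 0 ∧ 0 < (D f z).re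

end Univ

end

/-!
With `P(z) = f(z) / (z f'(z))` the functional is `D = (1 + P + z P') / P`. For each class except `𝒢`
and `𝒮`, the defining condition supplies a function `φ` with `|φ| ≤ 1` on the disk, and `D` becomes
a rational expression in `z`, `φ` and `φ'`:

* `𝒰`: `(z / f)² f' = 1 + z² φ` and `D = (2 - z³ φ') / (1 + z² φ)`;
* `𝒮*(1/2)`: `P = 1 - z φ` and `D = 2 - z² φ' / (1 - z φ)`;
* `𝒮*`: `P = (1 - z φ) / (1 + z φ)` and `D = 2 (1 - z² φ') / (1 - z² φ²)`.

The Schwarz–Pick inequality `|φ'| ≤ (1 - |φ|²) / (1 - |z|²)` (`schwarz_pick`) then gives `Re D > 0`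
in the stated disks. For `𝒮*(1/2)` it bounds the subtracted term by `2`; for the other two classes
it is combined with `re_div_pos`, which compares the arguments of two points near `1`. For `𝒮*` the
analytic condition `Re P ≥ 0` is derived from the geometric definition by applying the Schwarz lemma
to `f⁻¹(t f(z))`.

For `f` in `𝒢`, the Borel–Carathéodory inequality gives `|f'' / f'| ≤ 1 / (1 - |z|)`. Integration
along rays yields `|f - z f'| < |z f'|`, that is, `Re (z f' / f) > 1 / 2`, for `|z| < 2 / 3`, and
then `Re D > 2 · 1/2 - 1/2`.

For `f` in `𝒮`, write `f'(z) / (f(z + w) - f(z)) = 1 / w + G(w)`. The value at `w = -z` determines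
`z f'(z) / f(z)`, the number `G(0)` determines `z f''(z) / f'(z)`, and together they give
`D = 2 (1 - z (G(-z) - G(0)))`. So a bound for `|G'|` is all that is needed. It comes from a weak
form of the area theorem (`setIntegral_annulus_norm_deriv_sq_le`), proved by comparing the area of
the image of an annulus under `1 / w + G(w)` with that of a disk which contains this image.
-/

namespace Univ

open ComplexConjugate

/-! ### Bounded functions on the unit disk -/

lemma norm_one_sub_conj_mul_sq (b w : ℂ) :
    ‖1 - conj b * w‖ ^ 2 - ‖w - b‖ ^ 2 = (1 - ‖b‖ ^ 2) * (1 - ‖w‖ ^ 2) := by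
  simp only [← Complex.normSq_eq_norm_sq, Complex.normSq_apply, Complex.sub_re, Complex.sub_im,
    Complex.mul_re, Complex.mul_im, Complex.conj_re, Complex.conj_im, Complex.one_re,
    Complex.one_im]
  ring

lemma one_sub_conj_mul_ne_zero {b w : ℂ} (hb : ‖b‖ < 1) (hw : ‖w‖ ≤ 1) : 1 - conj b * w ≠ 0 := by
  intro h
  have h1 : ‖conj b * w‖ = 1 := by rw [← sub_eq_zero.mp h]; simp
  rw [norm_mul, RCLike.norm_conj] at h1
  nlinarith [norm_nonneg b, norm_nonneg w]

/-- The **Schwarz–Pick inequality** for the derivative of a self-map of the unit disk. -/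
theorem schwarz_pick {φ : ℂ → ℂ} (hφ : DifferentiableOn ℂ φ (ball 0 1))
    (hb : ∀ z ∈ ball (0 : ℂ) 1, ‖φ z‖ ≤ 1) {z : ℂ} (hz : z ∈ ball (0 : ℂ) 1) :
    ‖deriv φ z‖ * (1 - ‖z‖ ^ 2) ≤ 1 - ‖φ z‖ ^ 2 := by
  have hz1 : ‖z‖ < 1 := mem_ball_zero_iff.mp hz
  rcases (hb z hz).lt_or_eq with hlt | heq
  swap
  · -- a unimodular value forces `φ` to be constant
    have hc : Set.EqOn φ (Function.const ℂ (φ z)) (ball 0 1) :=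
      Complex.eqOn_of_isPreconnected_of_isMaxOn_norm (convex_ball _ _).isPreconnected isOpen_ball
        hφ hz fun w hw => by simpa [heq] using hb w hw
    have h0 : deriv φ z = 0 := by
      rw [(hc.eventuallyEq_of_mem (isOpen_ball.mem_nhds hz)).deriv_eq]
      exact deriv_const z (φ z)
    simp [h0, heq]
  set b := φ z with hb'
  let T : ℂ → ℂ := fun ζ => (ζ + z) / (1 + conj z * ζ)
  have hden : ∀ ζ ∈ ball (0 : ℂ) 1, 1 + conj z * ζ ≠ 0 := fun ζ hζ => by
    have := one_sub_conj_mul_ne_zero (b := -z) (w := ζ) (by simpa using hz1)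
      (mem_ball_zero_iff.mp hζ).le
    simpa using this
  have hT : Set.MapsTo T (ball 0 1) (ball 0 1) := fun ζ hζ => by
    have h1 := norm_one_sub_conj_mul_sq (-z) ζ
    have h2 : ‖ζ‖ < 1 := mem_ball_zero_iff.mp hζ
    have h3 := hden ζ hζ
    simp only [map_neg, neg_mul, sub_neg_eq_add, norm_neg] at h1
    rw [mem_ball_zero_iff, norm_div, div_lt_one (norm_pos_iff.mpr h3)]
    have h4 : 0 < (1 - ‖z‖ ^ 2) * (1 - ‖ζ‖ ^ 2) :=
      mul_pos (by nlinarith [norm_nonneg z]) (by nlinarith [norm_nonneg ζ])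
    exact lt_of_pow_lt_pow_left₀ 2 (norm_nonneg _) (by linarith)
  have hTd : DifferentiableOn ℂ T (ball 0 1) := by
    refine DifferentiableOn.div (by fun_prop) (by fun_prop) hden
  let H : ℂ → ℂ := fun ζ => (φ (T ζ) - b) / (1 - conj b * φ (T ζ))
  have hden2 : ∀ ζ ∈ ball (0 : ℂ) 1, 1 - conj b * φ (T ζ) ≠ 0 := fun ζ hζ =>
    one_sub_conj_mul_ne_zero hlt (hb _ (hT hζ))
  have hφT : DifferentiableOn ℂ (fun ζ => φ (T ζ)) (ball 0 1) := hφ.comp hTd hT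
  have hHd : DifferentiableOn ℂ H (ball 0 1) :=
    (hφT.sub_const b).div ((hφT.const_mul _).const_sub 1) hden2
  have hT0 : T 0 = z := by simp [T]
  have hH0 : H 0 = 0 := by simp [H, hT0, ← hb']
  have hHb : Set.MapsTo H (ball 0 1) (closedBall (H 0) 1) := fun ζ hζ => by
    have h1 := norm_one_sub_conj_mul_sq b (φ (T ζ))
    rw [hH0, mem_closedBall_zero_iff, norm_div, div_le_one (norm_pos_iff.mpr (hden2 ζ hζ))]
    have h2 := hb _ (hT hζ)
    have h4 : 0 ≤ (1 - ‖b‖ ^ 2) * (1 - ‖φ (T ζ)‖ ^ 2) :=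
      mul_nonneg (by nlinarith [norm_nonneg b]) (by nlinarith [norm_nonneg (φ (T ζ))])
    exact le_of_sq_le_sq (by linarith) (norm_nonneg _)
  have hle := Complex.norm_deriv_le_one_of_mapsTo_ball hHd hHb one_pos
  have hT' : HasDerivAt T (1 - conj z * z) 0 := by
    have := ((hasDerivAt_id (0 : ℂ)).add_const z).div
      (((hasDerivAt_id (0 : ℂ)).const_mul (conj z)).const_add 1) (by simp)
    exact this.congr_deriv (by simp [mul_comm])
  have hφ' : HasDerivAt φ (deriv φ z) (T 0) := by
    rw [hT0]; exact (hφ.differentiableAt (isOpen_ball.mem_nhds hz)).hasDerivAt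
  have hc := hφ'.comp (0 : ℂ) hT'
  have hbb : 1 - conj b * b ≠ 0 := one_sub_conj_mul_ne_zero hlt hlt.le
  have hH' : HasDerivAt H (deriv φ z * (1 - conj z * z) / (1 - conj b * b)) 0 := by
    have := (hc.sub_const b).div ((hc.const_mul (conj b)).const_sub 1)
      (by simpa [hT0, ← hb'] using hbb)
    refine this.congr_deriv ?_
    simp only [Function.comp_apply, hT0, ← hb']
    field_simp
    ring
  have hn : ∀ c : ℂ, ‖c‖ < 1 → ‖1 - conj c * c‖ = 1 - ‖c‖ ^ 2 := fun c hc => by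
    rw [Complex.conj_mul', ← Complex.ofReal_pow, ← Complex.ofReal_one, ← Complex.ofReal_sub,
      Complex.norm_real, Real.norm_of_nonneg]
    nlinarith [norm_nonneg c]
  rw [hH'.deriv, norm_div, norm_mul, hn z hz1, hn b hlt, div_le_one] at hle
  · exact hle
  · nlinarith [norm_nonneg b]

/-- Division by `z` in the Schwarz lemma: a function bounded by `1` on the unit disk that vanishes
at the origin is `z φ(z)` with `φ` again bounded by `1`. -/
theorem exists_eq_mul_of_norm_le_one {ω : ℂ → ℂ} (hω : DifferentiableOn ℂ ω (ball 0 1))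
    (hb : ∀ z ∈ ball (0 : ℂ) 1, ‖ω z‖ ≤ 1) (h0 : ω 0 = 0) :
    ∃ φ : ℂ → ℂ, DifferentiableOn ℂ φ (ball 0 1) ∧ (∀ z ∈ ball (0 : ℂ) 1, ‖φ z‖ ≤ 1) ∧
      (∀ z, ω z = z * φ z) ∧ φ 0 = deriv ω 0 := by
  refine ⟨dslope ω 0, (Complex.differentiableOn_dslope (ball_mem_nhds _ one_pos)).mpr hω,
    fun z hz => ?_, fun z => ?_, dslope_same _ _⟩
  · simpa using Complex.norm_dslope_le_div_of_mapsTo_ball (R₂ := 1) hω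
      (fun w hw => by simpa [h0] using hb w hw) hz
  · simpa [h0] using (sub_smul_dslope ω 0 z).symm

/-- Two points `1 + p` and `1 + q` with `|p|² + |q|² < 1` have arguments that differ by
less than `π / 2`: the disks `|w - 1| ≤ sin α` and `|w - 1| ≤ cos α` are seen from the
origin under the half-angles `α` and `π / 2 - α`. -/
lemma re_div_pos {p q : ℂ} (h : ‖p‖ ^ 2 + ‖q‖ ^ 2 < 1) : 0 < ((1 + p) / (1 + q)).re := by
  have hq : 1 + q ≠ 0 := fun h0 => by
    have : q = -1 := by linear_combination h0
    rw [this] at h; simp at h; nlinarith [norm_nonneg p]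
  rw [Complex.div_re, ← add_div]
  refine div_pos ?_ (Complex.normSq_pos.mpr hq)
  simp only [← Complex.normSq_eq_norm_sq, Complex.normSq_apply] at h
  simp only [Complex.add_re, Complex.add_im, Complex.one_re, Complex.one_im]
  nlinarith [sq_nonneg (1 + p.re + q.re), sq_nonneg (p.im + q.im)]

/-- With `a` at its upper bound the left side is convex in `x ^ 2`, so it is largest at `x = 0` or
`x = 1`. In the applications `x = |φ|`, and the hypothesis on `a` comes from the Schwarz–Pick
inequality. -/
lemma sq_add_sq_lt_one {a κ s x : ℝ} (ha : 0 ≤ a) (hκ : 0 ≤ κ) (hκ1 : κ < 1) (hs : 0 ≤ s)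
    (hs1 : s < 1) (hx : 0 ≤ x) (hx1 : x ≤ 1) (h : a ≤ κ * (1 - x ^ 2)) :
    a ^ 2 + (s * x) ^ 2 < 1 := by
  have h1 : 0 ≤ 1 - x ^ 2 := by nlinarith
  have h2 : a ^ 2 ≤ (κ * (1 - x ^ 2)) ^ 2 := pow_le_pow_left₀ ha h 2
  have h3 : (κ * (1 - x ^ 2)) ^ 2 ≤ κ * (1 - x ^ 2) := by
    have : κ * (1 - x ^ 2) ≤ 1 := by nlinarith
    nlinarith [mul_nonneg hκ h1]
  have h4 : s ^ 2 < 1 := by nlinarith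
  rcases eq_or_lt_of_le h1 with h5 | h5
  · have : x ^ 2 = 1 := by linarith
    rw [← h5] at h2 h3
    nlinarith
  · nlinarith [mul_pos h5 (sub_pos.mpr hκ1), mul_nonneg (sub_nonneg.mpr h4.le) (sq_nonneg x)]

lemma norm_sub_one_lt_one_iff {p : ℂ} (hp : p ≠ 0) : ‖p - 1‖ < 1 ↔ 1 / 2 < (1 / p).re := by
  have h0 := Complex.normSq_pos.mpr hp
  rw [← sq_lt_one_iff₀ (norm_nonneg _), ← Complex.normSq_eq_norm_sq, one_div p, Complex.inv_re,
    lt_div_iff₀ h0]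
  simp only [Complex.normSq_apply, Complex.sub_re, Complex.sub_im, Complex.one_re, Complex.one_im]
  constructor <;> intro h <;> linarith

/-! ### The functional `D` in terms of the quotients `f(z) / z` and `f(z) / (z f'(z))` -/

lemma ClassA.differentiableOn {f : ℂ → ℂ} (hf : ClassA f) : DifferentiableOn ℂ f (ball 0 1) :=
  hf.1.differentiableOn

lemma ClassA.differentiableOn_deriv {f : ℂ → ℂ} (hf : ClassA f) :
    DifferentiableOn ℂ (deriv f) (ball 0 1) :=
  hf.1.deriv.differentiableOn

/-- The function `f(z) / z`, with its removable singularity filled in. -/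
noncomputable def quot (f : ℂ → ℂ) : ℂ → ℂ := dslope f 0

namespace ClassA

variable {f : ℂ → ℂ}

lemma differentiableOn_quot (hf : ClassA f) : DifferentiableOn ℂ (quot f) (ball 0 1) :=
  (Complex.differentiableOn_dslope (ball_mem_nhds _ one_pos)).mpr hf.differentiableOn

lemma eq_mul_quot (hf : ClassA f) (z : ℂ) : f z = z * quot f z := by
  simpa [quot, hf.2.1] using (sub_smul_dslope f 0 z).symm

lemma quot_zero (hf : ClassA f) : quot f 0 = 1 := by
  rw [quot, dslope_same, hf.2.2]

lemma quot_ne_zero (hf : ClassA f) {z : ℂ} (h : z ≠ 0 → f z ≠ 0) : quot f z ≠ 0 := by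
  rcases eq_or_ne z 0 with rfl | hz
  · simp [hf.quot_zero]
  · exact fun h0 => h hz (by rw [hf.eq_mul_quot, h0, mul_zero])

lemma deriv_eq (hf : ClassA f) {z : ℂ} (hz : z ∈ ball (0 : ℂ) 1) :
    deriv f z = quot f z + z * deriv (quot f) z := by
  have h := (hasDerivAt_id z).mul
    (hf.differentiableOn_quot.differentiableAt (isOpen_ball.mem_nhds hz)).hasDerivAt
  have he : f = id * quot f := funext fun w => by simpa using hf.eq_mul_quot w
  conv_lhs => rw [he]
  simpa using h.deriv

lemma logQuot_eq (hf : ClassA f) (z : ℂ) :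
    logQuot f z = deriv f z / quot f z := by
  unfold logQuot
  split_ifs with hz
  · rw [hz, hf.quot_zero, hf.2.2, div_one]
  · rw [hf.eq_mul_quot, mul_div_mul_left _ _ hz]

/-- With `P(z) = f(z) / (z f'(z))`, the functional is `D = (1 + P + z P') / P`. -/
lemma D_eq_of_hasDerivAt (hf : ClassA f) {z P' : ℂ} (hz : z ∈ ball (0 : ℂ) 1)
    (h : z ≠ 0 → f z ≠ 0) (hd : deriv f z ≠ 0)
    (hP : HasDerivAt (fun w => quot f w / deriv f w) P' z) :
    D f z = (1 + quot f z / deriv f z + z * P') / (quot f z / deriv f z) := by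
  have hk := hf.quot_ne_zero h
  have h1 := (hf.differentiableOn_quot.differentiableAt (isOpen_ball.mem_nhds hz)).hasDerivAt
  have h2 := (hf.differentiableOn_deriv.differentiableAt (isOpen_ball.mem_nhds hz)).hasDerivAt
  have h3 := hP.unique (h1.div h2 hd)
  have h4 : z * deriv (quot f) z = deriv f z - quot f z := by rw [hf.deriv_eq hz]; ring
  unfold D
  rw [hf.logQuot_eq z, h3]
  field_simp
  linear_combination (-deriv f z) * h4

end ClassA

/-! ### The class `𝒰` -/

lemma re_D_pos_of_classU {f : ℂ → ℂ} (hf : ClassU f) {z : ℂ} (hz : ‖z‖ < 1)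
    (hr : ‖z‖ ^ 3 < 2 * (1 - ‖z‖ ^ 2)) :
    (z ≠ 0 → f z ≠ 0) ∧ deriv f z ≠ 0 ∧ 0 < (D f z).re := by
  obtain ⟨hA, hU⟩ := hf
  have hkne : ∀ w ∈ ball (0 : ℂ) 1, quot f w ≠ 0 := fun w hw =>
    hA.quot_ne_zero fun h0 => (hU w hw h0).1
  have hkd := hA.differentiableOn_quot
  have hzb : z ∈ ball (0 : ℂ) 1 := mem_ball_zero_iff.mpr hz
  let g : ℂ → ℂ := fun w => (quot f w)⁻¹
  have hgd : DifferentiableOn ℂ g (ball 0 1) := hkd.inv hkne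
  have hgd' : DifferentiableOn ℂ (deriv g) (ball 0 1) := hgd.deriv isOpen_ball
  -- `ω = (z / f)² f' - 1`; in terms of `g = z / f` it is clear that `ω'(0) = 0`
  let ω : ℂ → ℂ := fun w => g w - w * deriv g w - 1
  have hωd : DifferentiableOn ℂ ω (ball 0 1) :=
    (hgd.sub (differentiableOn_id.mul hgd')).sub_const 1
  have hω' : ∀ w ∈ ball (0 : ℂ) 1, HasDerivAt ω (-(w * deriv (deriv g) w)) w := fun w hw => by
    have h1 := (hgd.differentiableAt (isOpen_ball.mem_nhds hw)).hasDerivAt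
    have h2 := (hgd'.differentiableAt (isOpen_ball.mem_nhds hw)).hasDerivAt
    exact ((h1.sub ((hasDerivAt_id w).mul h2)).sub_const 1).congr_deriv (by simp)
  have hf' : ∀ w ∈ ball (0 : ℂ) 1, deriv f w = (1 + ω w) * quot f w ^ 2 := fun w hw => by
    have h1 := (hkd.differentiableAt (isOpen_ball.mem_nhds hw)).hasDerivAt.inv (hkne w hw)
    have h2 : deriv g w = -deriv (quot f) w / quot f w ^ 2 := h1.deriv
    have := hkne w hw
    simp only [ω, h2, g]
    rw [hA.deriv_eq hw]
    field_simp
    ring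
  have hω0 : ω 0 = 0 := by simp [ω, g, hA.quot_zero]
  have hωlt : ∀ w ∈ ball (0 : ℂ) 1, ‖ω w‖ < 1 := fun w hw => by
    rcases eq_or_ne w 0 with rfl | hw0
    · simp [hω0]
    · have h1 := (hU w hw hw0).2
      have hk := hkne w hw
      have h2 : (w / f w) ^ 2 * deriv f w - 1 = ω w := by
        rw [hf' w hw, hA.eq_mul_quot w]
        field_simp
        ring
      rwa [h2] at h1
  have hne : 1 + ω z ≠ 0 := fun h0 => by
    have := hωlt z hzb
    rw [show ω z = -1 by linear_combination h0] at this
    simp at this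
  have hkz := hkne z hzb
  have hfz : z ≠ 0 → f z ≠ 0 := fun h0 => (hU z hzb h0).1
  refine ⟨hfz, by rw [hf' z hzb]; exact mul_ne_zero hne (pow_ne_zero 2 hkz), ?_⟩
  obtain ⟨ψ, hψd, hψb, hψ, hψ0⟩ :=
    exists_eq_mul_of_norm_le_one hωd (fun w hw => (hωlt w hw).le) hω0
  rw [(hω' 0 (mem_ball_self one_pos)).deriv] at hψ0
  obtain ⟨φ, hφd, hφb, hφ, -⟩ := exists_eq_mul_of_norm_le_one hψd hψb (by simpa using hψ0)
  have hωφ : ω = fun w => w ^ 2 * φ w := funext fun w => by rw [hψ, hφ]; ring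
  have hφ' := (hφd.differentiableAt (isOpen_ball.mem_nhds hzb)).hasDerivAt
  have hω'z : HasDerivAt ω (2 * z * φ z + z ^ 2 * deriv φ z) z := by
    rw [hωφ]
    exact ((hasDerivAt_pow 2 z).mul hφ').congr_deriv (by simp)
  have hk' := (hkd.differentiableAt (isOpen_ball.mem_nhds hzb)).hasDerivAt
  have hf'' : deriv (deriv f) z = (2 * z * φ z + z ^ 2 * deriv φ z) * quot f z ^ 2
      + (1 + ω z) * (2 * quot f z * deriv (quot f) z) := by
    have h1 : deriv f =ᶠ[nhds z] fun w => (1 + ω w) * quot f w ^ 2 :=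
      Filter.eventuallyEq_of_mem (isOpen_ball.mem_nhds hzb) hf'
    rw [h1.deriv_eq]
    exact (((hω'z.const_add 1).mul (hk'.pow 2)).congr_deriv (by simp)).deriv
  have hone : (1 + ω z) * quot f z ^ 2 = quot f z + z * deriv (quot f) z := by
    rw [← hf' z hzb, hA.deriv_eq hzb]
  have hωz : ω z = z ^ 2 * φ z := congrFun hωφ z
  have hD : D f z = 2 * ((1 + -(z ^ 3 * deriv φ z / 2)) / (1 + z ^ 2 * φ z)) := by
    unfold D
    rw [hA.logQuot_eq z, hf'', hf' z hzb, ← hωz]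
    have h2 : z * deriv (quot f) z = (1 + ω z) * quot f z ^ 2 - quot f z := by
      rw [hone]; ring
    field_simp
    rw [hωz] at h2 ⊢
    linear_combination (-2 * (1 + z ^ 2 * φ z)) * h2
  have hsp := schwarz_pick hφd hφb hzb
  rw [hD, show (2 : ℂ) = ((2 : ℝ) : ℂ) by simp, Complex.re_ofReal_mul]
  refine mul_pos two_pos (re_div_pos ?_)
  have hx := hφb z hzb
  simp only [norm_neg, norm_div, norm_mul, norm_pow, Complex.norm_real, Real.norm_eq_abs, abs_two]
  have h1 : 0 < 1 - ‖z‖ ^ 2 := by nlinarith [norm_nonneg z]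
  refine sq_add_sq_lt_one (κ := ‖z‖ ^ 3 / (2 * (1 - ‖z‖ ^ 2))) (by positivity) (by positivity)
    ((div_lt_one (by positivity)).mpr hr) (by positivity) (by nlinarith [norm_nonneg z])
    (norm_nonneg _) hx ?_
  rw [div_mul_eq_mul_div, div_le_div_iff₀ two_pos (by positivity)]
  nlinarith [mul_le_mul_of_nonneg_left hsp (by positivity : 0 ≤ 2 * ‖z‖ ^ 3)]

/-! ### The class `𝒮*(1/2)` -/

lemma re_D_pos_of_classStarOrder_half {f : ℂ → ℂ} (hf : ClassStarOrder (1 / 2) f) {z : ℂ}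
    (hr : ‖z‖ ^ 2 + ‖z‖ ^ 4 < 1) :
    (z ≠ 0 → f z ≠ 0) ∧ deriv f z ≠ 0 ∧ 0 < (D f z).re := by
  obtain ⟨hA, hne, hre⟩ := hf
  have hz : ‖z‖ < 1 := by
    by_contra! h
    nlinarith [one_le_pow₀ h (n := 2), one_le_pow₀ h (n := 4)]
  have hzb : z ∈ ball (0 : ℂ) 1 := mem_ball_zero_iff.mpr hz
  have hkne : ∀ w ∈ ball (0 : ℂ) 1, quot f w ≠ 0 := fun w hw => hA.quot_ne_zero (hne w hw)
  have hdne : ∀ w ∈ ball (0 : ℂ) 1, deriv f w ≠ 0 := fun w hw h0 => by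
    have := hre w hw
    rw [hA.logQuot_eq w, h0, zero_div, Complex.zero_re] at this
    norm_num at this
  refine ⟨hne z hzb, hdne z hzb, ?_⟩
  -- `Re (z f' / f) > 1 / 2` says that `P = f / (z f')` satisfies `|1 - P| < 1`
  let ω : ℂ → ℂ := fun w => 1 - quot f w / deriv f w
  have hωd : DifferentiableOn ℂ ω (ball 0 1) :=
    (hA.differentiableOn_quot.div hA.differentiableOn_deriv hdne).const_sub 1
  have hωlt : ∀ w ∈ ball (0 : ℂ) 1, ‖ω w‖ < 1 := fun w hw => by
    rw [norm_sub_rev, norm_sub_one_lt_one_iff (div_ne_zero (hkne w hw) (hdne w hw)),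
      one_div_div, ← hA.logQuot_eq w]
    exact hre w hw
  have hω0 : ω 0 = 0 := by simp [ω, hA.quot_zero, hA.2.2]
  obtain ⟨φ, hφd, hφb, hφ, -⟩ :=
    exists_eq_mul_of_norm_le_one hωd (fun w hw => (hωlt w hw).le) hω0
  have hφ' := (hφd.differentiableAt (isOpen_ball.mem_nhds hzb)).hasDerivAt
  have hPφ : (fun w => quot f w / deriv f w) = fun w => 1 - w * φ w := funext fun w => by
    rw [← hφ]; simp [ω]
  have hP' : HasDerivAt (fun w => quot f w / deriv f w) (-(φ z + z * deriv φ z)) z := by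
    rw [hPφ]
    exact (((hasDerivAt_id z).mul hφ').const_sub 1).congr_deriv (by simp)
  have hPz : quot f z / deriv f z = 1 - z * φ z := congrFun hPφ z
  have hPne : 1 - z * φ z ≠ 0 := by
    rw [← hPz]; exact div_ne_zero (hkne z hzb) (hdne z hzb)
  have hD : D f z = 2 - z ^ 2 * deriv φ z / (1 - z * φ z) := by
    rw [hA.D_eq_of_hasDerivAt hzb (hne z hzb) (hdne z hzb) hP', hPz]
    field_simp
    ring
  have hsp := schwarz_pick hφd hφb hzb
  have hx := hφb z hzb
  have hlow : 1 - ‖z‖ * ‖φ z‖ ≤ ‖1 - z * φ z‖ := by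
    simpa using norm_sub_norm_le (1 : ℂ) (z * φ z)
  have hzx : ‖z‖ * ‖φ z‖ < 1 := by nlinarith [norm_nonneg z, norm_nonneg (φ z)]
  have h1 : 0 < 1 - ‖z‖ ^ 2 := by nlinarith [norm_nonneg z]
  have hkey : ‖z ^ 2 * deriv φ z / (1 - z * φ z)‖ < 2 := by
    rw [norm_div, div_lt_iff₀ (by linarith), norm_mul, norm_pow]
    -- `2 (1 - r²)(1 - r x) - r² (1 - x²) = (r x - (1 - r²))² + (1 - r² - r⁴)`
    have h2 : ‖z‖ ^ 2 * (1 - ‖φ z‖ ^ 2) < 2 * (1 - ‖z‖ * ‖φ z‖) * (1 - ‖z‖ ^ 2) := by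
      nlinarith [sq_nonneg (‖z‖ * ‖φ z‖ - (1 - ‖z‖ ^ 2))]
    have h3 : ‖z‖ ^ 2 * ‖deriv φ z‖ < 2 * (1 - ‖z‖ * ‖φ z‖) := by
      refine lt_of_mul_lt_mul_right ?_ h1.le
      nlinarith [mul_le_mul_of_nonneg_left hsp (sq_nonneg ‖z‖)]
    linarith
  rw [hD, Complex.sub_re]
  have := (Complex.re_le_norm _).trans_lt hkey
  simpa using this

/-! ### The class `𝒢` -/

/-- Functions in `𝒢` are starlike of order `1/2` in `|z| < 2/3`. -/
lemma norm_sub_mul_deriv_lt_of_classG {f : ℂ → ℂ} (hf : ClassG f) {z : ℂ} (hz0 : z ≠ 0)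
    (hz : ‖z‖ < 2 / 3) : ‖f z - z * deriv f z‖ < ‖z * deriv f z‖ := by
  obtain ⟨hA, hG⟩ := hf
  set r := ‖z‖ with hr
  have hr0 : 0 < r := norm_pos_iff.mpr hz0
  have hzt : ∀ t ∈ Set.Icc (0 : ℝ) 1, (t : ℂ) * z ∈ ball (0 : ℂ) 1 := fun t ht => by
    rw [mem_ball_zero_iff, norm_mul, Complex.norm_real, Real.norm_of_nonneg ht.1]
    nlinarith [ht.1, ht.2]
  have hnt : ∀ t ∈ Set.Icc (0 : ℝ) 1, ‖(t : ℂ) * z‖ = t * r := fun t ht => by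
    rw [norm_mul, Complex.norm_real, Real.norm_of_nonneg ht.1]
  have hd'd := hA.differentiableOn_deriv
  have hd''d : DifferentiableOn ℂ (deriv (deriv f)) (ball 0 1) := hd'd.deriv isOpen_ball
  -- Borel–Carathéodory for `w f'' / f'`, whose real part is less than `1 / 2`
  have hbc : ∀ w ∈ ball (0 : ℂ) 1,
      ‖w * deriv (deriv f) w / deriv f w‖ ≤ ‖w‖ / (1 - ‖w‖) := fun w hw => by
    have := Complex.borelCaratheodory_zero (M := 1 / 2) (R := 1) (z := w)
      (f := fun w => w * deriv (deriv f) w / deriv f w) (by norm_num)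
      ((differentiableOn_id.mul hd''d).div hd'd fun w hw => (hG w hw).1)
      (fun w hw => by
        have := (hG w hw).2
        rw [Complex.add_re, Complex.one_re] at this
        simp only [Set.mem_ofPred_eq]
        linarith) one_pos hw (by simp)
    simpa using this
  have hray : ∀ t ∈ Set.Ioo (0 : ℝ) 1,
      ‖z * deriv (deriv f) (t * z)‖ ≤ r / (1 - t * r) * ‖deriv f (t * z)‖ := fun t ht => by
    have ht' := Set.Ioo_subset_Icc_self ht
    have h1 := hbc _ (hzt t ht')
    have hpos := norm_pos_iff.mpr (hG _ (hzt t ht')).1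
    have h3 : 0 < 1 - t * r := by nlinarith [ht.1, ht.2]
    rw [norm_div, div_le_iff₀ hpos, hnt t ht', mul_assoc, norm_mul, Complex.norm_real,
      Real.norm_of_nonneg ht.1.le, mul_div_assoc, mul_assoc] at h1
    exact le_of_mul_le_mul_left h1 ht.1
  have hcl : ∀ t : ℝ, HasDerivAt (fun t : ℝ => (t : ℂ) * z) z t := fun t => by
    simpa using (Complex.ofRealCLM.hasDerivAt (x := t)).mul_const z
  have hF' : ∀ t ∈ Set.Icc (0 : ℝ) 1,
      HasDerivAt (fun t : ℝ => deriv f (t * z)) (deriv (deriv f) (t * z) * z) t := fun t ht =>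
    HasDerivAt.comp_of_eq t
      (hd'd.differentiableAt (isOpen_ball.mem_nhds (hzt t ht))).hasDerivAt (hcl t) rfl
  have hF : ∀ t ∈ Set.Icc (0 : ℝ) 1,
      HasDerivAt (fun t : ℝ => f (t * z)) (deriv f (t * z) * z) t := fun t ht =>
    HasDerivAt.comp_of_eq t
      (hA.differentiableOn.differentiableAt (isOpen_ball.mem_nhds (hzt t ht))).hasDerivAt
      (hcl t) rfl
  -- hence `|f'(t z)| / (1 - t r)` is increasing along the ray
  have hmono : MonotoneOn (fun t : ℝ => ‖deriv f (t * z)‖ ^ 2 / (1 - t * r) ^ 2)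
      (Set.Icc 0 1) := by
    have hder : ∀ t ∈ Set.Icc (0 : ℝ) 1,
        HasDerivAt (fun t : ℝ => ‖deriv f (t * z)‖ ^ 2 / (1 - t * r) ^ 2)
          ((2 * inner ℝ (deriv f (t * z)) (deriv (deriv f) (t * z) * z) * (1 - t * r) ^ 2 -
            ‖deriv f (t * z)‖ ^ 2 * (2 * (1 - t * r) * (-r))) / ((1 - t * r) ^ 2) ^ 2) t :=
      fun t ht => by
        have h3 : 0 < 1 - t * r := by nlinarith [ht.1, ht.2]
        have h4 : HasDerivAt (fun t : ℝ => 1 - t * r) (-r) t := by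
          simpa using ((hasDerivAt_id t).mul_const r).const_sub 1
        exact ((hF' t ht).norm_sq.div (h4.pow 2) (pow_ne_zero 2 h3.ne')).congr_deriv (by simp)
    refine monotoneOn_of_hasDerivWithinAt_nonneg (convex_Icc 0 1)
      (fun t ht => (hder t ht).continuousAt.continuousWithinAt)
      (fun t ht => (hder t (interior_subset ht)).hasDerivWithinAt) fun t ht => ?_
    rw [interior_Icc] at ht
    have h3 : 0 < 1 - t * r := by nlinarith [ht.1, ht.2]
    refine div_nonneg ?_ (by positivity)
    have h5 := abs_le.mp (abs_real_inner_le_norm (deriv f (t * z)) (deriv (deriv f) (t * z) * z))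
    have h6 := hray t ht
    rw [mul_comm z] at h6
    have h7 := mul_le_mul_of_nonneg_left h6 (norm_nonneg (deriv f (t * z)))
    have h8 : ‖deriv f (t * z)‖ * (r / (1 - t * r) * ‖deriv f (t * z)‖) * (1 - t * r)
        = r * ‖deriv f (t * z)‖ ^ 2 := by
      have h9 := div_mul_cancel₀ r h3.ne'
      linear_combination ‖deriv f (t * z)‖ ^ 2 * h9
    nlinarith [mul_le_mul_of_nonneg_right (h5.1.trans' (neg_le_neg h7)) h3.le]
  have hle : ∀ t ∈ Set.Icc (0 : ℝ) 1,
      ‖deriv f (t * z)‖ / (1 - t * r) ≤ ‖deriv f z‖ / (1 - r) := fun t ht => by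
    have h1 := hmono ht (Set.right_mem_Icc.mpr zero_le_one) ht.2
    have h3 : 0 < 1 - t * r := by nlinarith [ht.1, ht.2]
    have h4 : 0 < 1 - r := by linarith
    simp only [← div_pow, Complex.ofReal_one, one_mul] at h1
    exact le_of_sq_le_sq h1 (by positivity)
  set C := ‖deriv f z‖ / (1 - r) with hC
  have hC0 : 0 ≤ C := div_nonneg (norm_nonneg _) (by linarith)
  have hk : ∀ t ∈ Set.Icc (0 : ℝ) 1, HasDerivAt
      (fun t : ℝ => f (t * z) - t * z * deriv f (t * z))
      (-(t * z * (deriv (deriv f) (t * z) * z))) t := fun t ht =>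
    ((hF t ht).sub ((hcl t).mul (hF' t ht))).congr_deriv (by ring)
  have hfin : ‖f ((1 : ℝ) * z) - (1 : ℝ) * z * deriv f ((1 : ℝ) * z)‖ ≤ r ^ 2 * C * (1 ^ 2 / 2) := by
    refine image_norm_le_of_norm_deriv_right_le_deriv_boundary (a := 0) (b := 1)
      (B := fun t => r ^ 2 * C * (t ^ 2 / 2)) (B' := fun t => r ^ 2 * C * t)
      (f := fun t : ℝ => f (t * z) - t * z * deriv f (t * z))
      (fun t ht => (hk t ht).continuousAt.continuousWithinAt)
      (fun t ht => (hk t (Set.Ico_subset_Icc_self ht)).hasDerivWithinAt) ?_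
      (fun t => ?_) (fun t ht => ?_) (Set.right_mem_Icc.mpr zero_le_one)
    · simp [hA.2.1]
    · exact (((hasDerivAt_pow 2 t).div_const 2).const_mul (r ^ 2 * C)).congr_deriv
        (by simp)
    · rcases ht.1.eq_or_lt with h0 | h0
      · simp [← h0]
      · have h1 := hray t ⟨h0, ht.2⟩
        have h2 := hle t (Set.Ico_subset_Icc_self ht)
        have h3 : 0 < 1 - t * r := by nlinarith [ht.1, ht.2]
        rw [norm_neg, norm_mul, hnt t (Set.Ico_subset_Icc_self ht), mul_comm _ z]
        calc t * r * ‖z * deriv (deriv f) (t * z)‖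
            ≤ t * r * (r / (1 - t * r) * ‖deriv f (t * z)‖) := by gcongr
          _ = t * r ^ 2 * (‖deriv f (t * z)‖ / (1 - t * r)) := by ring
          _ ≤ t * r ^ 2 * C := by gcongr
          _ = r ^ 2 * C * t := by ring
  simp only [Complex.ofReal_one, one_mul] at hfin
  have hpos : 0 < ‖deriv f z‖ :=
    norm_pos_iff.mpr (hG z (mem_ball_zero_iff.mpr (by linarith))).1
  refine hfin.trans_lt ?_
  rw [norm_mul, ← hr, hC]
  have h4 : 0 < 1 - r := by linarith
  rw [show r ^ 2 * (‖deriv f z‖ / (1 - r)) * (1 ^ 2 / 2) = r ^ 2 * ‖deriv f z‖ / 2 / (1 - r) by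
    ring, div_lt_iff₀ h4]
  nlinarith [mul_pos hr0 hpos, mul_pos (mul_pos hr0 hpos) (sub_pos.mpr hz)]

lemma re_D_pos_of_classG {f : ℂ → ℂ} (hf : ClassG f) {z : ℂ} (hz : ‖z‖ < 2 / 3) :
    (z ≠ 0 → f z ≠ 0) ∧ deriv f z ≠ 0 ∧ 0 < (D f z).re := by
  obtain ⟨hd, hre⟩ := hf.2 z (mem_ball_zero_iff.mpr (by linarith))
  rw [Complex.add_re, Complex.one_re] at hre
  have hfz : z ≠ 0 → f z ≠ 0 := fun h0 h => by
    have := norm_sub_mul_deriv_lt_of_classG hf h0 hz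
    rw [h, zero_sub, norm_neg] at this
    exact this.false
  refine ⟨hfz, hd, ?_⟩
  have hlog : 1 / 2 < (logQuot f z).re := by
    unfold logQuot
    split_ifs with h0
    · norm_num
    · have hne : z * deriv f z ≠ 0 := mul_ne_zero h0 hd
      have h1 := norm_sub_mul_deriv_lt_of_classG hf h0 hz
      have h2 : ‖f z / (z * deriv f z) - 1‖ < 1 := by
        rwa [div_sub_one hne, norm_div, div_lt_one (norm_pos_iff.mpr hne)]
      rwa [norm_sub_one_lt_one_iff (div_ne_zero (hfz h0) hne), one_div_div] at h2
  unfold D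
  rw [Complex.sub_re, show (2 : ℂ) = ((2 : ℝ) : ℂ) by simp, Complex.re_ofReal_mul]
  linarith

/-! ### Univalent functions and the class `𝒮*` -/

/-- The inverse of a univalent function is holomorphic. It is continuous by the open mapping
theorem, and holomorphic away from the isolated critical values, which are therefore removable. -/
theorem differentiableOn_invFunOn {f : ℂ → ℂ} {U : Set ℂ} (hU : IsOpen U)
    (hc : IsPreconnected U) (hf : DifferentiableOn ℂ f U) (hinj : Set.InjOn f U) :
    IsOpen (f '' U) ∧ DifferentiableOn ℂ (Function.invFunOn f U) (f '' U) := by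
  have hA : AnalyticOnNhd ℂ f U := hf.analyticOnNhd hU
  have hleft : ∀ z ∈ U, Function.invFunOn f U (f z) = z := fun z hz => hinj.leftInvOn_invFunOn hz
  rcases U.eq_empty_or_nonempty with rfl | ⟨z₀, hz₀⟩
  · simp [differentiableOn_empty]
  have hnc : ¬ ∃ w, ∀ z ∈ U, f z = w := by
    rintro ⟨w, hw⟩
    have hs : U.Subsingleton := fun x hx y hy => hinj hx hy ((hw x hx).trans (hw y hy).symm)
    have := hs.eq_singleton_of_mem hz₀
    exact not_isOpen_singleton z₀ (this ▸ hU)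
  have hopen := (hA.is_constant_or_isOpen hc).resolve_left hnc
  have hfU : IsOpen (f '' U) := hopen U subset_rfl hU
  have hcont : ∀ z ∈ U, ContinuousAt (Function.invFunOn f U) (f z) := fun z hz => by
    rw [ContinuousAt, hleft z hz]
    intro s hs
    obtain ⟨t, hts, hto, hzt⟩ := _root_.mem_nhds_iff.mp (Filter.inter_mem hs (hU.mem_nhds hz))
    rw [Filter.mem_map]
    refine Filter.mem_of_superset ((hopen t (fun x hx => (hts hx).2) hto).mem_nhds ⟨z, hzt, rfl⟩) ?_
    rintro _ ⟨x, hx, rfl⟩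
    rw [Set.mem_preimage, hleft x (hts hx).2]
    exact (hts hx).1
  have hdiff : ∀ z ∈ U, deriv f z ≠ 0 → DifferentiableAt ℂ (Function.invFunOn f U) (f z) :=
    fun z hz hd => by
      refine (HasDerivAt.of_local_left_inverse (f := f) (f' := deriv f z) (hcont z hz) ?_ hd
        ?_).differentiableAt
      · rw [hleft z hz]
        exact (hf.differentiableAt (hU.mem_nhds hz)).hasDerivAt
      · filter_upwards [hfU.mem_nhds ⟨z, hz, rfl⟩] with w hw
        exact Function.invFunOn_eq hw
  refine ⟨hfU, ?_⟩
  rintro _ ⟨z, hz, rfl⟩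
  refine DifferentiableAt.differentiableWithinAt ?_
  rcases (hA z hz).deriv.eventually_eq_zero_or_eventually_ne_zero with h0 | h0
  · obtain ⟨ε, hε, hb⟩ := Metric.eventually_nhds_iff_ball.mp (h0.and (hU.mem_nhds hz))
    have hconst : ∀ w ∈ ball z ε, f w = f z := fun w hw =>
      (convex_ball z ε).is_const_of_fderivWithin_eq_zero (𝕜 := ℂ)
        (hf.mono fun x hx => (hb x hx).2) (fun x hx => by
          rw [fderivWithin_of_isOpen isOpen_ball hx]
          ext
          simp [(hb x hx).1]) hw (mem_ball_self hε)
    have hs : ball z ε = {z} := Set.Subset.antisymm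
      (fun w hw => hinj (hb w hw).2 hz (hconst w hw)) (by simpa using hε)
    exact absurd (hs ▸ isOpen_ball) (not_isOpen_singleton z)
  · refine (Complex.analyticAt_of_differentiable_on_punctured_nhds_of_continuousAt ?_
      (hcont z hz)).differentiableAt
    obtain ⟨t, ht, hto, hzt⟩ := _root_.mem_nhds_iff.mp
      (Filter.inter_mem (eventually_nhdsWithin_iff.mp h0) (hU.mem_nhds hz))
    rw [eventually_nhdsWithin_iff]
    filter_upwards [(hopen t (fun x hx => (ht hx).2) hto).mem_nhds ⟨z, hzt, rfl⟩] with w hw hne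
    obtain ⟨x, hx, rfl⟩ := hw
    exact hdiff x (ht hx).2 ((ht hx).1 fun h => hne (by rw [Set.mem_singleton_iff.mp h]; rfl))

theorem deriv_ne_zero_of_injOn {f : ℂ → ℂ} {U : Set ℂ} (hU : IsOpen U)
    (hc : IsPreconnected U) (hf : DifferentiableOn ℂ f U) (hinj : Set.InjOn f U) {z : ℂ}
    (hz : z ∈ U) : deriv f z ≠ 0 := by
  obtain ⟨hV, hg⟩ := differentiableOn_invFunOn hU hc hf hinj
  have h1 := (hg.differentiableAt (hV.mem_nhds ⟨z, hz, rfl⟩)).hasDerivAt.comp z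
    (hf.differentiableAt (hU.mem_nhds hz)).hasDerivAt
  have h2 : Function.invFunOn f U ∘ f =ᶠ[nhds z] id := by
    filter_upwards [hU.mem_nhds hz] with w hw using hinj.leftInvOn_invFunOn hw
  have h3 := h1.unique ((hasDerivAt_id z).congr_of_eventuallyEq h2)
  intro h0
  simp [h0] at h3

/-- The analytic form of starlikeness. For `0 ≤ t ≤ 1` the map `f⁻¹(t f(z))` is a self-map of
the disk fixing the origin, so it does not increase `|z|`; the derivative in `t` at `t = 1`
then gives `Re (z̄ f(z) / f'(z)) ≥ 0`. -/
lemma re_quot_div_deriv_nonneg {f : ℂ → ℂ} (hf : ClassStar f) {z : ℂ}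
    (hz : z ∈ ball (0 : ℂ) 1) : 0 ≤ (quot f z / deriv f z).re := by
  obtain ⟨⟨hA, hinj⟩, hstar⟩ := hf
  rcases eq_or_ne z 0 with rfl | hz0
  · simp [hA.quot_zero, hA.2.2]
  obtain ⟨hV, hg⟩ := differentiableOn_invFunOn isOpen_ball (convex_ball (0 : ℂ) 1).isPreconnected
    hA.differentiableOn hinj
  set g := Function.invFunOn f (ball 0 1) with hgdef
  have hleft : ∀ w ∈ ball (0 : ℂ) 1, g (f w) = w := fun w hw => hinj.leftInvOn_invFunOn hw
  have hd := deriv_ne_zero_of_injOn isOpen_ball (convex_ball (0 : ℂ) 1).isPreconnected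
    hA.differentiableOn hinj hz
  have hmem : ∀ t ∈ Set.Icc (0 : ℝ) 1, ∀ w ∈ ball (0 : ℂ) 1, (t : ℂ) * f w ∈ f '' ball 0 1 :=
    fun t ht w hw => by
      have := hstar (Set.mem_image_of_mem f hw) (sub_nonneg.mpr ht.2) ht.1 (by ring)
      simpa using this
  have hle : ∀ t ∈ Set.Icc (0 : ℝ) 1, ‖g (t * f z)‖ ≤ ‖z‖ := fun t ht => by
    refine Complex.norm_le_norm_of_mapsTo_ball (R := 1) (f := fun w => g (t * f w)) ?_ ?_ ?_
      (mem_ball_zero_iff.mp hz)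
    · exact hg.comp (hA.differentiableOn.const_mul _) fun w hw => hmem t ht w hw
    · exact fun w hw => ball_subset_closedBall (Function.invFunOn_mem (hmem t ht w hw))
    · have := hleft 0 (mem_ball_self one_pos)
      rw [hA.2.1] at this
      simp [hA.2.1, this]
  have hg' : HasDerivAt g (1 / deriv f z) (f z) := by
    have h1 := (hg.differentiableAt (hV.mem_nhds ⟨z, hz, rfl⟩)).hasDerivAt
    have h2 := h1.comp z (hA.differentiableOn.differentiableAt
      (isOpen_ball.mem_nhds hz)).hasDerivAt
    have h3 : g ∘ f =ᶠ[nhds z] id := by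
      filter_upwards [isOpen_ball.mem_nhds hz] with w hw using hleft w hw
    have h4 := h2.unique ((hasDerivAt_id z).congr_of_eventuallyEq h3)
    exact h1.congr_deriv (by rw [eq_div_iff hd, h4])
  have hcurve : HasDerivAt (fun t : ℝ => g (t * f z)) (1 / deriv f z * f z) 1 := by
    refine HasDerivAt.comp_of_eq (1 : ℝ) hg' ?_ (by simp)
    simpa using (Complex.ofRealCLM.hasDerivAt (x := (1 : ℝ))).mul_const (f z)
  have hsq := hcurve.norm_sq
  simp only [Complex.ofReal_one, one_mul, hleft z hz] at hsq
  have hnonneg : 0 ≤ 2 * inner ℝ z (1 / deriv f z * f z) := by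
    by_contra! hneg
    -- a negative derivative at `t = 1` would make `|g(t f(z))|` exceed `|z|` for some `t < 1`
    have h1 := (hasDerivAt_iff_tendsto_slope.mp hsq).eventually (gt_mem_nhds hneg)
    have h2 : ∀ᶠ t in nhdsWithin (1 : ℝ) (Set.Iio 1), slope (fun t : ℝ => ‖g (t * f z)‖ ^ 2) 1 t
        < 0 := h1.filter_mono (nhdsWithin_mono _ fun t ht => ne_of_lt ht)
    have h3 : ∀ᶠ t in nhdsWithin (1 : ℝ) (Set.Iio 1), t ∈ Set.Ioo (0 : ℝ) 1 :=
      Ioo_mem_nhdsLT one_pos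
    obtain ⟨t, ht, ht'⟩ := (h2.and h3).exists
    have h4 := hle t ⟨ht'.1.le, ht'.2.le⟩
    rw [slope_def_field] at ht
    simp only [Complex.ofReal_one, one_mul, hleft z hz] at ht
    have h5 : ‖g (t * f z)‖ ^ 2 ≤ ‖z‖ ^ 2 := pow_le_pow_left₀ (norm_nonneg _) h4 2
    exact ht.not_ge (div_nonneg_of_nonpos (by linarith) (by linarith [ht'.2]))
  have hkey : inner ℝ z (1 / deriv f z * f z) = ‖z‖ ^ 2 * (quot f z / deriv f z).re := by
    rw [hA.eq_mul_quot z, ← Complex.normSq_eq_norm_sq, ← Complex.re_ofReal_mul,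
      ← Complex.mul_conj, Complex.inner]
    congr 1
    ring
  rw [hkey] at hnonneg
  have : 0 < ‖z‖ ^ 2 := by have := norm_pos_iff.mpr hz0; positivity
  by_contra! hneg
  nlinarith [mul_pos this (neg_pos.mpr hneg)]

lemma re_D_pos_of_classStar {f : ℂ → ℂ} (hf : ClassStar f) {z : ℂ} (hr : ‖z‖ ^ 2 < 1 / 2) :
    (z ≠ 0 → f z ≠ 0) ∧ deriv f z ≠ 0 ∧ 0 < (D f z).re := by
  have hz : ‖z‖ < 1 := by nlinarith [norm_nonneg z]
  have hPre := fun w hw => re_quot_div_deriv_nonneg hf (z := w) hw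
  obtain ⟨⟨hA, hinj⟩, -⟩ := hf
  have hne : ∀ w ∈ ball (0 : ℂ) 1, w ≠ 0 → f w ≠ 0 := fun w hw h0 h =>
    h0 (hinj hw (mem_ball_self one_pos) (by rw [h, hA.2.1]))
  have hzb : z ∈ ball (0 : ℂ) 1 := mem_ball_zero_iff.mpr hz
  have hkne : ∀ w ∈ ball (0 : ℂ) 1, quot f w ≠ 0 := fun w hw => hA.quot_ne_zero (hne w hw)
  have hdne : ∀ w ∈ ball (0 : ℂ) 1, deriv f w ≠ 0 := fun w hw =>
    deriv_ne_zero_of_injOn isOpen_ball (convex_ball (0 : ℂ) 1).isPreconnected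
      hA.differentiableOn hinj hw
  refine ⟨hne z hzb, hdne z hzb, ?_⟩
  let P : ℂ → ℂ := fun w => quot f w / deriv f w
  have hPd : DifferentiableOn ℂ P (ball 0 1) :=
    hA.differentiableOn_quot.div hA.differentiableOn_deriv hdne
  have hP1 : ∀ w ∈ ball (0 : ℂ) 1, 1 + P w ≠ 0 := fun w hw h => by
    have h1 : 0 ≤ (P w).re := hPre w hw
    rw [show P w = -1 by linear_combination h] at h1
    norm_num at h1
  -- the Cayley transform of `P = f / (z f')`
  let ω : ℂ → ℂ := fun w => (1 - P w) / (1 + P w)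
  have hωd : DifferentiableOn ℂ ω (ball 0 1) := (hPd.const_sub 1).div (hPd.const_add 1) hP1
  have hωb : ∀ w ∈ ball (0 : ℂ) 1, ‖ω w‖ ≤ 1 := fun w hw => by
    have h1 : 0 ≤ (P w).re := hPre w hw
    rw [norm_div, div_le_one (norm_pos_iff.mpr (hP1 w hw))]
    refine le_of_sq_le_sq ?_ (norm_nonneg _)
    simp only [← Complex.normSq_eq_norm_sq, Complex.normSq_apply, Complex.sub_re, Complex.sub_im,
      Complex.add_re, Complex.add_im, Complex.one_re, Complex.one_im]
    nlinarith
  have hω0 : ω 0 = 0 := by simp [ω, P, hA.quot_zero, hA.2.2]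
  obtain ⟨φ, hφd, hφb, hφ, -⟩ := exists_eq_mul_of_norm_le_one hωd hωb hω0
  have hPω : ∀ w ∈ ball (0 : ℂ) 1, 1 + w * φ w ≠ 0 ∧ P w = (1 - w * φ w) / (1 + w * φ w) :=
    fun w hw => by
      have h1 := hP1 w hw
      have h2 : 1 + w * φ w = 2 / (1 + P w) := by
        rw [← hφ]; simp only [ω]; field_simp; ring
      have h3 : 1 + w * φ w ≠ 0 := by rw [h2]; exact div_ne_zero two_ne_zero h1
      refine ⟨h3, ?_⟩
      rw [eq_div_iff h3, ← hφ]
      simp only [ω]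
      field_simp
      ring
  have hφ' := (hφd.differentiableAt (isOpen_ball.mem_nhds hzb)).hasDerivAt
  obtain ⟨h1ne, hPz⟩ := hPω z hzb
  have hP' : HasDerivAt P (-2 * (φ z + z * deriv φ z) / (1 + z * φ z) ^ 2) z := by
    have hzφ := (hasDerivAt_id z).mul hφ'
    refine HasDerivAt.congr_of_eventuallyEq (f := fun w => (1 - w * φ w) / (1 + w * φ w)) ?_
      (Filter.eventuallyEq_of_mem (isOpen_ball.mem_nhds hzb) fun w hw => (hPω w hw).2)
    refine ((hzφ.const_sub 1).div (hzφ.const_add 1) h1ne).congr_deriv ?_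
    simp only [Pi.mul_apply, id_eq]
    field_simp
    ring
  have h2ne : 1 - z * φ z ≠ 0 := fun h => by
    rw [h, zero_div] at hPz
    exact div_ne_zero (hkne z hzb) (hdne z hzb) hPz
  have h3ne : 1 - z ^ 2 * φ z ^ 2 ≠ 0 := by
    have := mul_ne_zero h1ne h2ne
    intro h
    exact this (by linear_combination h)
  have hD : D f z = 2 * ((1 + -(z ^ 2 * deriv φ z)) / (1 + -(z ^ 2 * φ z ^ 2))) := by
    rw [hA.D_eq_of_hasDerivAt hzb (hne z hzb) (hdne z hzb) hP',
      show quot f z / deriv f z = _ from hPz, ← sub_eq_add_neg, ← sub_eq_add_neg]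
    have h4 : 1 - z ^ 2 * φ z ^ 2 = (1 - z * φ z) * (1 + z * φ z) := by ring
    rw [h4]
    field_simp
    ring
  have hsp := schwarz_pick hφd hφb hzb
  have hx := hφb z hzb
  rw [hD, show (2 : ℂ) = ((2 : ℝ) : ℂ) by simp, Complex.re_ofReal_mul]
  refine mul_pos two_pos (re_div_pos ?_)
  simp only [norm_neg, norm_mul, norm_pow]
  have h1 : 0 < 1 - ‖z‖ ^ 2 := by nlinarith [norm_nonneg z]
  have hxx : ‖φ z‖ ^ 2 ≤ ‖φ z‖ := by nlinarith [norm_nonneg (φ z)]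
  have h5 : (‖z‖ ^ 2 * ‖φ z‖ ^ 2) ^ 2 ≤ (‖z‖ ^ 2 * ‖φ z‖) ^ 2 := by gcongr
  refine (add_le_add_right h5 _).trans_lt ?_
  refine sq_add_sq_lt_one (κ := ‖z‖ ^ 2 / (1 - ‖z‖ ^ 2)) (by positivity) (by positivity)
    ((div_lt_one h1).mpr (by linarith)) (by positivity) (by linarith) (norm_nonneg _) hx ?_
  rw [div_mul_eq_mul_div, le_div_iff₀ h1, mul_assoc]
  exact mul_le_mul_of_nonneg_left hsp (sq_nonneg _)

/-! ### Area integrals over annuli -/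

open MeasureTheory Real

/-- The mean value property over an annulus, with a radial weight. -/
theorem setIntegral_annulus {u : ℂ → ℂ} {c : ℂ} {s R R' : ℝ} {k : ℝ → ℝ} (hs : 0 ≤ s)
    (hR : R < R') (hk : ContinuousOn k (Set.Icc s R)) (hu : DifferentiableOn ℂ u (ball c R')) :
    ∫ z in {z : ℂ | ‖z - c‖ ∈ Set.Ioo s R}, (k ‖z - c‖ : ℂ) * u z =
      ((2 * π * ∫ r in Set.Ioo s R, r * k r : ℝ) : ℂ) * u c := by
  let F : ℝ × ℝ → ℂ := fun p => ((p.1 * k p.1 : ℝ) : ℂ) * u (circleMap c p.1 p.2)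
  have hcont : ContinuousOn F (Set.Icc s R ×ˢ Set.Icc (-π) π) := by
    refine ContinuousOn.mul ?_ ?_
    · refine Complex.continuous_ofReal.comp_continuousOn ?_
      exact continuousOn_fst.mul (hk.comp continuousOn_fst fun p hp => hp.1)
    · refine hu.continuousOn.comp (Continuous.continuousOn ?_) fun p hp => ?_
      · unfold circleMap; fun_prop
      · rw [mem_ball, dist_eq_norm, circleMap_sub_center, norm_circleMap_zero,
          abs_of_nonneg (hs.trans hp.1.1)]
        exact hp.1.2.trans_lt hR
  have hint : IntegrableOn F (Set.Ioo s R ×ˢ Set.Ioo (-π) π) :=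
    (hcont.integrableOn_compact (isCompact_Icc.prod isCompact_Icc)).mono_set
      (Set.prod_mono Set.Ioo_subset_Icc_self Set.Ioo_subset_Icc_self)
  have hmeas : MeasurableSet {z : ℂ | ‖z - c‖ ∈ Set.Ioo s R} :=
    (by fun_prop : Measurable fun z : ℂ => ‖z - c‖) measurableSet_Ioo
  have hpolar : ∫ z in {z : ℂ | ‖z - c‖ ∈ Set.Ioo s R}, (k ‖z - c‖ : ℂ) * u z =
      ∫ p in Set.Ioo s R ×ˢ Set.Ioo (-π) π, F p := by
    rw [← integral_indicator hmeas, ← integral_add_right_eq_self _ c,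
      ← Complex.integral_comp_polarCoord_symm, polarCoord_target]
    have hset : Set.Ioo s R ×ˢ Set.Ioo (-π) π =
        (Set.Ioi (0 : ℝ) ×ˢ Set.Ioo (-π) π) ∩ (Set.Ioo s R ×ˢ Set.univ) := by
      ext p
      simp only [Set.mem_prod, Set.mem_Ioo, Set.mem_inter_iff, Set.mem_Ioi, Set.mem_univ]
      constructor
      · rintro ⟨h1, h2⟩; exact ⟨⟨hs.trans_lt h1.1, h2⟩, h1, trivial⟩
      · rintro ⟨⟨_, h2⟩, h1, _⟩; exact ⟨h1, h2⟩
    rw [hset, ← setIntegral_indicator (measurableSet_Ioo.prod MeasurableSet.univ)]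
    refine setIntegral_congr_fun (measurableSet_Ioi.prod measurableSet_Ioo) fun p hp => ?_
    have hp0 : 0 < p.1 := hp.1
    have hnorm : ‖circleMap c p.1 p.2 - c‖ = p.1 := by
      rw [circleMap_sub_center, norm_circleMap_zero, abs_of_pos hp0]
    have hcm : Complex.polarCoord.symm p + c = circleMap c p.1 p.2 := by
      rw [Complex.polarCoord_symm_apply, circleMap, Complex.exp_mul_I, add_comm]
      push_cast
      rfl
    simp only [Set.indicator_apply, Set.mem_ofPred_eq, hcm, hnorm, Set.mem_prod,
      Set.mem_univ, and_true, F]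
    split_ifs
    · rw [Complex.real_smul]; push_cast; ring
    · simp
  rw [hpolar, Measure.volume_eq_prod, setIntegral_prod _ hint]
  have hinner : ∀ r ∈ Set.Ioo s R, ∫ θ in Set.Ioo (-π) π, F (r, θ) =
      ((2 * π * (r * k r) : ℝ) : ℂ) * u c := fun r hr => by
    have hr0 : 0 ≤ r := hs.trans hr.1.le
    have hav : Real.circleAverage u c r = u c := by
      refine DiffContOnCl.circleAverage ?_
      rw [abs_of_nonneg hr0]
      exact (hu.mono (closedBall_subset_ball (hr.2.trans hR))).diffContOnCl_ball subset_rfl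
    have hI : ∫ θ in Set.Ioo (-π) π, u (circleMap c r θ) = (2 * π : ℝ) * u c := by
      rw [← hav, Real.circleAverage_eq_integral_add (-π),
        intervalIntegral.integral_comp_add_right (fun θ => u (circleMap c r θ)) (-π),
        show 0 + -π = -π by ring, show 2 * π + -π = π by ring,
        intervalIntegral.integral_of_le (by linarith [pi_pos]), integral_Ioc_eq_integral_Ioo,
        Complex.real_smul, ← mul_assoc, ← Complex.ofReal_mul,
        mul_inv_cancel₀ (by positivity), Complex.ofReal_one, one_mul]
    simp only [F]
    rw [integral_const_mul, hI]
    push_cast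
    ring
  rw [setIntegral_congr_fun measurableSet_Ioo hinner, integral_mul_const, integral_complex_ofReal,
    integral_const_mul]

lemma det_smul_one (a : ℂ) : (a • (1 : ℂ →L[ℝ] ℂ)).det = ‖a‖ ^ 2 := by
  have h : ((a • (1 : ℂ →L[ℝ] ℂ) : ℂ →L[ℝ] ℂ) : ℂ →ₗ[ℝ] ℂ) = Algebra.lmul ℝ ℂ a := by
    ext; all_goals simp
  rw [ContinuousLinearMap.det, h, ← Algebra.norm_apply, Algebra.norm_complex_apply,
    Complex.normSq_eq_norm_sq]

/-- If a univalent function maps `A` into a disk of radius `T`, then `∫_A |φ'|²`, the area of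
the image, is at most `π T²`. -/
theorem setIntegral_norm_deriv_sq_le {φ φ' : ℂ → ℂ} {A : Set ℂ} {b : ℂ} {T : ℝ}
    (hA : MeasurableSet A) (hφ : ∀ z ∈ A, HasDerivAt φ (φ' z) z) (hinj : Set.InjOn φ A)
    (hT : 0 ≤ T) (hsub : ∀ z ∈ A, ‖φ z - b‖ ≤ T) : ∫ z in A, ‖φ' z‖ ^ 2 ≤ π * T ^ 2 := by
  have h := integral_image_eq_integral_abs_det_fderiv_smul volume hA
    (fun z hz => (hφ z hz).complexToReal_fderiv.hasFDerivWithinAt) hinj (fun _ => (1 : ℝ))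
  simp only [det_smul_one, smul_eq_mul, mul_one, abs_pow, abs_norm] at h
  rw [← h, setIntegral_const, smul_eq_mul, mul_one]
  refine (measureReal_mono (s₂ := closedBall b T) ?_ ?_).trans ?_
  · rintro _ ⟨z, hz, rfl⟩
    rw [mem_closedBall, dist_eq_norm]
    exact hsub z hz
  · exact measure_closedBall_lt_top.ne
  · rw [measureReal_def, Complex.volume_closedBall]
    simp [hT, mul_comm]

/-- The area form of the subharmonicity of `|u|²`. -/
theorem mul_norm_sq_le_setIntegral {u : ℂ → ℂ} {w : ℂ} {δ ρ R : ℝ} (hδ : 0 ≤ δ) (hρ : ρ < R)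
    (hw : ‖w‖ + δ ≤ ρ) (hu : DifferentiableOn ℂ u (ball 0 R)) :
    π * δ ^ 2 * ‖u w‖ ^ 2 ≤ ∫ z in ball (0 : ℂ) ρ, ‖u z‖ ^ 2 := by
  have hint : IntegrableOn (fun z => ‖u z‖ ^ 2) (ball (0 : ℂ) ρ) :=
    (((hu.continuousOn.mono (closedBall_subset_ball hρ)).norm.pow 2).integrableOn_compact
      (isCompact_closedBall 0 ρ)).mono_set ball_subset_closedBall
  have h := setIntegral_annulus (u := fun z => u z ^ 2) (c := w) (s := 0) (R := δ)
    (R' := R - ‖w‖) (k := fun _ => 1) le_rfl (by linarith) continuousOn_const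
    ((hu.mono fun z hz => by
      rw [mem_ball_zero_iff]
      rw [mem_ball, dist_eq_norm] at hz
      linarith [norm_le_norm_sub_add z w]).pow 2)
  have hI : ∫ r in Set.Ioo 0 δ, r * (1 : ℝ) = δ ^ 2 / 2 := by
    simp only [mul_one]
    rw [← integral_Ioc_eq_integral_Ioo, ← intervalIntegral.integral_of_le hδ, integral_id]
    ring
  rw [hI] at h
  simp only [Complex.ofReal_one, one_mul] at h
  have h2 := norm_integral_le_integral_norm (μ := volume.restrict {z : ℂ | ‖z - w‖ ∈ Set.Ioo 0 δ})
    (fun z => u z ^ 2)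
  rw [h, norm_mul, Complex.norm_real, Real.norm_of_nonneg (by positivity)] at h2
  simp only [norm_pow] at h2
  refine le_trans (le_of_eq (by ring)) (h2.trans ?_)
  have hsub : {z : ℂ | ‖z - w‖ ∈ Set.Ioo 0 δ} ≤ ball (0 : ℂ) ρ := fun z hz => by
    rw [mem_ball_zero_iff]
    linarith [norm_le_norm_sub_add z w, hz.2]
  exact setIntegral_mono_set hint (Filter.Eventually.of_forall fun z => by positivity)
    hsub.eventuallyLE

/-! ### A form of the area theorem -/

/-- If `1 / w + G(w)` is univalent, then it maps the outside of the disk `|w| ≤ s` into the disk of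
radius `1 / s + s M` about `G(0)`, because every value farther out is taken in `|w| ≤ s`: the
equation `w = 1 / (v - G(w))` has a solution there. -/
lemma norm_inv_add_sub_le {G : ℂ → ℂ} {R s M : ℝ} (hG : DifferentiableOn ℂ G (ball 0 R))
    (hs : 0 < s) (hsR : s < R) (hM : ∀ w ∈ closedBall (0 : ℂ) s, ‖deriv G w‖ ≤ M)
    (hinj : Set.InjOn (fun w => w⁻¹ + G w) (ball 0 R \ {0})) {w : ℂ} (hw : w ∈ ball (0 : ℂ) R)
    (hsw : s < ‖w‖) : ‖w⁻¹ + G w - G 0‖ ≤ 1 / s + s * M := by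
  by_contra! hlt
  set v := w⁻¹ + G w with hv
  have hsub : closedBall (0 : ℂ) s ⊆ ball 0 R := closedBall_subset_ball hsR
  have hosc : ∀ x ∈ closedBall (0 : ℂ) s, ‖G x - G 0‖ ≤ s * M := fun x hx => by
    have h1 := (convex_closedBall (0 : ℂ) s).norm_image_sub_le_of_norm_deriv_le
      (fun y hy => hG.differentiableAt (isOpen_ball.mem_nhds (hsub hy))) hM
      (mem_closedBall_self hs.le) hx
    rw [sub_zero] at h1
    have h2 : ‖x‖ ≤ s := by simpa using hx
    have h3 : 0 ≤ M := (norm_nonneg _).trans (hM 0 (mem_closedBall_self hs.le))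
    nlinarith
  have hfar : ∀ x ∈ closedBall (0 : ℂ) s, 1 / s < ‖v - G x‖ := fun x hx => by
    have h1 := norm_sub_norm_le (v - G 0) (G x - G 0)
    rw [sub_sub_sub_cancel_right] at h1
    linarith [hosc x hx]
  have hpos : ∀ x ∈ closedBall (0 : ℂ) s, v - G x ≠ 0 := fun x hx =>
    norm_pos_iff.mp ((one_div_pos.mpr hs).trans (hfar x hx))
  let H : ℂ → ℂ := fun x => (v - G x)⁻¹
  have hHs : ∀ x ∈ closedBall (0 : ℂ) s, ‖H x‖ < s := fun x hx => by
    rw [norm_inv]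
    exact inv_lt_of_inv_lt₀ hs (by simpa using hfar x hx)
  have hfix : ∀ x ∈ closedBall (0 : ℂ) s, x - H x ≠ 0 := fun x hx h => by
    have h1 : x = (v - G x)⁻¹ := sub_eq_zero.mp h
    have hx0 : x ≠ 0 := by rw [h1]; exact inv_ne_zero (hpos x hx)
    have h2 : x⁻¹ + G x = v := by
      have := congrArg (·⁻¹) h1
      simp only [inv_inv] at this
      rw [this, sub_add_cancel]
    have hw0 : w ≠ 0 := norm_pos_iff.mp (hs.trans hsw)
    have h3 := hinj ⟨hsub hx, hx0⟩ ⟨hw, hw0⟩ h2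
    rw [h3, mem_closedBall_zero_iff] at hx
    linarith
  -- With no fixed point, `E = x / (x - H x)` is holomorphic; but `Re E > 1 / 2` on the circle
  -- `|x| = s`, while `E 0 = 0`, against the maximum principle for `exp (-E)`.
  let E : ℂ → ℂ := fun x => x / (x - H x)
  have hEd : DifferentiableOn ℂ (fun x => Complex.exp (-E x)) (closedBall 0 s) := by
    refine (DifferentiableOn.div differentiableOn_id (differentiableOn_id.sub
      (DifferentiableOn.inv ((hG.mono hsub).const_sub v) hpos)) hfix).neg.cexp
  have hmax := Complex.norm_le_of_forall_mem_frontier_norm_le (U := ball (0 : ℂ) s)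
    (f := fun x => Complex.exp (-E x)) (C := Real.exp (-(1 / 2))) isBounded_ball
    (hEd.diffContOnCl_ball subset_rfl) (fun x hx => by
      rw [frontier_ball _ hs.ne', mem_sphere_zero_iff_norm] at hx
      have hx' : x ∈ closedBall (0 : ℂ) s := by simp [hx]
      have hx0 : x ≠ 0 := norm_pos_iff.mp (hx ▸ hs)
      rw [Complex.norm_exp, Real.exp_le_exp, Complex.neg_re, neg_le_neg_iff]
      have h1 : ‖(1 - H x / x) - 1‖ < 1 := by
        rw [sub_sub_cancel_left, norm_neg, norm_div, hx, div_lt_one hs]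
        exact hHs x hx'
      have h2 : 1 - H x / x = (x - H x) / x := by field_simp
      rw [h2, norm_sub_one_lt_one_iff (div_ne_zero (hfix x hx') hx0), one_div_div] at h1
      exact h1.le) (subset_closure (mem_ball_self hs))
  simp [E] at hmax
  norm_num at hmax

/-- The area theorem on an annulus. By orthogonality of the powers of `w` on circles, the area of
the image under `1 / w + G(w)` is the sum of the areas that belong to `1 / w` and to `G`. -/
theorem setIntegral_annulus_norm_deriv_sq_le {G : ℂ → ℂ} {R s ρ M : ℝ}
    (hG : DifferentiableOn ℂ G (ball 0 R)) (hs : 0 < s) (hsρ : s < ρ) (hρR : ρ < R)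
    (hM : ∀ w ∈ closedBall (0 : ℂ) s, ‖deriv G w‖ ≤ M)
    (hinj : Set.InjOn (fun w => w⁻¹ + G w) (ball 0 R \ {0})) :
    ∫ z in {z : ℂ | ‖z‖ ∈ Set.Ioo s ρ}, ‖deriv G z‖ ^ 2 ≤
      π * (2 * M + s ^ 2 * M ^ 2 + 1 / ρ ^ 2) := by
  have hM0 : 0 ≤ M := (norm_nonneg _).trans (hM 0 (mem_closedBall_self hs.le))
  have hG' : DifferentiableOn ℂ (deriv G) (ball 0 R) := hG.deriv isOpen_ball
  set A : Set ℂ := {z : ℂ | ‖z‖ ∈ Set.Ioo s ρ} with hA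
  have hmeas : MeasurableSet A := measurable_norm measurableSet_Ioo
  have hAR : ∀ z ∈ A, z ∈ ball (0 : ℂ) R ∧ z ≠ 0 := fun z hz =>
    ⟨mem_ball_zero_iff.mpr (hz.2.trans hρR), norm_pos_iff.mp (hs.trans hz.1)⟩
  let u : ℂ → ℂ := fun z => 1 - 2 * (z ^ 2 * deriv G z)
  have hu : DifferentiableOn ℂ u (ball 0 R) :=
    (((differentiableOn_id.pow 2).mul hG').const_mul 2).const_sub 1
  have hk : ContinuousOn (fun r : ℝ => (r ^ 4)⁻¹) (Set.Icc s ρ) :=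
    (continuousOn_pow 4).inv₀ fun r hr => pow_ne_zero 4 (hs.trans_le hr.1).ne'
  have h1 := setIntegral_annulus (c := 0) hs.le hρR hk hu
  simp only [sub_zero] at h1
  have hI : ∫ r in Set.Ioo s ρ, r * (r ^ 4)⁻¹ = (1 / s ^ 2 - 1 / ρ ^ 2) / 2 := by
    rw [← integral_Ioc_eq_integral_Ioo, ← intervalIntegral.integral_of_le hsρ.le]
    have hd : ∀ r ∈ Set.uIcc s ρ, HasDerivAt (fun r : ℝ => -(r ^ 2)⁻¹ / 2) (r * (r ^ 4)⁻¹) r :=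
      fun r hr => by
        rw [Set.uIcc_of_le hsρ.le] at hr
        have hr0 : r ≠ 0 := (hs.trans_le hr.1).ne'
        refine (((hasDerivAt_pow 2 r).inv (pow_ne_zero 2 hr0)).neg.div_const 2).congr_deriv ?_
        field_simp
        norm_num [mul_comm]
    rw [intervalIntegral.integral_eq_sub_of_hasDerivAt hd]
    · ring
    · refine ContinuousOn.intervalIntegrable ?_
      rw [Set.uIcc_of_le hsρ.le]
      exact continuousOn_id.mul hk
  rw [hI] at h1
  have hAc : A ⊆ {z : ℂ | ‖z‖ ∈ Set.Icc s ρ} := fun z hz => Set.Ioo_subset_Icc_self hz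
  have hcpt : IsCompact {z : ℂ | ‖z‖ ∈ Set.Icc s ρ} := by
    refine (isCompact_closedBall (0 : ℂ) ρ).of_isClosed_subset
      (isClosed_Icc.preimage continuous_norm) fun z hz => ?_
    exact mem_closedBall_zero_iff.mpr hz.2
  have hcR : {z : ℂ | ‖z‖ ∈ Set.Icc s ρ} ⊆ ball 0 R := fun z hz =>
    mem_ball_zero_iff.mpr (hz.2.trans_lt hρR)
  have hint1 : IntegrableOn (fun z => ‖deriv G z‖ ^ 2) A :=
    (((hG'.continuousOn.mono hcR).norm.pow 2).integrableOn_compact hcpt).mono_set hAc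
  have hint2 : IntegrableOn (fun z => (((‖z‖ ^ 4)⁻¹ : ℝ) : ℂ) * u z) A := by
    refine ContinuousOn.integrableOn_compact hcpt (ContinuousOn.mul ?_
      (hu.continuousOn.mono hcR)) |>.mono_set hAc
    exact Complex.continuous_ofReal.comp_continuousOn (hk.comp continuous_norm.continuousOn
      fun z hz => hz)
  have hsplit : ∀ z ∈ A, ‖-(z ^ 2)⁻¹ + deriv G z‖ ^ 2 =
      ‖deriv G z‖ ^ 2 + ((((‖z‖ ^ 4)⁻¹ : ℝ) : ℂ) * u z).re := fun z hz => by
    have hz0 := (hAR z hz).2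
    have hn : (‖z‖ : ℂ) ≠ 0 := by simpa using hz0
    have h2 : conj (z ^ 2)⁻¹ = ((‖z‖ ^ 4)⁻¹ : ℝ) * z ^ 2 := by
      have h3 : conj z * z = (‖z‖ : ℂ) ^ 2 := Complex.conj_mul' z
      have h4 : conj z ≠ 0 := by simpa using hz0
      rw [map_inv₀, map_pow]
      push_cast
      rw [show (‖z‖ : ℂ) ^ 4 = ((‖z‖ : ℂ) ^ 2) ^ 2 by ring, ← h3]
      field_simp
    have h5 : ‖(z ^ 2)⁻¹‖ ^ 2 = (‖z‖ ^ 4)⁻¹ := by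
      rw [norm_inv, norm_pow, inv_pow]; ring
    have h6 : ∀ p q : ℂ, ‖-p + q‖ ^ 2 = ‖q‖ ^ 2 + (‖p‖ ^ 2 - 2 * (conj p * q).re) := fun p q => by
      simp only [← Complex.normSq_eq_norm_sq, Complex.normSq_apply, Complex.add_re,
        Complex.add_im, Complex.neg_re, Complex.neg_im, Complex.mul_re, Complex.conj_re,
        Complex.conj_im]
      ring
    rw [h6, h5, h2, Complex.re_ofReal_mul, mul_assoc, Complex.re_ofReal_mul]
    simp only [u, Complex.sub_re, Complex.one_re]
    rw [show (2 : ℂ) = ((2 : ℝ) : ℂ) by simp, Complex.re_ofReal_mul]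
    ring
  have harea := setIntegral_norm_deriv_sq_le (φ := fun w => w⁻¹ + G w)
    (φ' := fun z => -(z ^ 2)⁻¹ + deriv G z) (b := G 0) (T := 1 / s + s * M) hmeas
    (fun z hz => (hasDerivAt_inv (hAR z hz).2).add
      (hG.differentiableAt (isOpen_ball.mem_nhds (hAR z hz).1)).hasDerivAt)
    (hinj.mono fun z hz => hAR z hz) (by positivity)
    (fun z hz => norm_inv_add_sub_le hG hs (hsρ.trans hρR) hM hinj (hAR z hz).1 hz.1)
  rw [setIntegral_congr_fun hmeas hsplit] at harea
  have hadd := integral_add hint1 hint2.re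
  simp only [RCLike.re_eq_complex_re] at hadd
  rw [hadd] at harea
  have hre : ∫ z in A, ((((‖z‖ ^ 4)⁻¹ : ℝ) : ℂ) * u z).re = π * (1 / s ^ 2 - 1 / ρ ^ 2) := by
    have := integral_re hint2
    simp only [RCLike.re_eq_complex_re] at this
    rw [this, h1, Complex.re_ofReal_mul]
    simp [u]
    ring
  rw [hre] at harea
  have hexp : (1 / s + s * M) ^ 2 = 1 / s ^ 2 + 2 * M + s ^ 2 * M ^ 2 := by
    field_simp
    ring
  rw [hexp] at harea
  linarith

/-- If `1 / w + G(w)` is univalent in `0 < |w| < 3/4`, then `|G'| ≤ 10` for `|w| ≤ 1/4`.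
The area bound, with `s = 1/8` and `ρ = 7/10`, and subharmonicity first give a quadratic
inequality for `M = max |G'|` over `|w| ≤ 1/8`, which implies `M ≤ 8`. -/
theorem norm_deriv_le_of_injOn {G : ℂ → ℂ} (hG : DifferentiableOn ℂ G (ball 0 (3 / 4)))
    (hinj : Set.InjOn (fun w => w⁻¹ + G w) (ball 0 (3 / 4) \ {0})) {w : ℂ} (hw : ‖w‖ ≤ 1 / 4) :
    ‖deriv G w‖ ≤ 10 := by
  have hG' : DifferentiableOn ℂ (deriv G) (ball 0 (3 / 4)) := hG.deriv isOpen_ball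
  have hsub : closedBall (0 : ℂ) (1 / 8) ⊆ ball 0 (3 / 4) := closedBall_subset_ball (by norm_num)
  obtain ⟨w₀, hw₀, hmax⟩ := (isCompact_closedBall (0 : ℂ) (1 / 8)).exists_isMaxOn
    ⟨0, by simp⟩ (hG'.continuousOn.mono hsub).norm
  set M := ‖deriv G w₀‖ with hMdef
  have hM : ∀ z ∈ closedBall (0 : ℂ) (1 / 8), ‖deriv G z‖ ≤ M := fun z hz => hmax hz
  have hM0 : 0 ≤ M := norm_nonneg _
  have hann := setIntegral_annulus_norm_deriv_sq_le (s := 1 / 8) (ρ := 7 / 10) hG (by norm_num)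
    (by norm_num) (by norm_num) hM hinj
  have hintc : IntegrableOn (fun z => ‖deriv G z‖ ^ 2) (closedBall (0 : ℂ) (7 / 10)) :=
    ((hG'.continuousOn.mono (closedBall_subset_ball (by norm_num))).norm.pow 2).integrableOn_compact
      (isCompact_closedBall 0 _)
  have hunion : ball (0 : ℂ) (7 / 10) =
      closedBall 0 (1 / 8) ∪ {z : ℂ | ‖z‖ ∈ Set.Ioo (1 / 8 : ℝ) (7 / 10)} := by
    ext z
    simp only [mem_ball_zero_iff, Set.mem_union, mem_closedBall_zero_iff, Set.mem_ofPred_eq,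
      Set.mem_Ioo]
    constructor
    · intro h
      rcases le_or_gt ‖z‖ (1 / 8) with h1 | h1
      · exact Or.inl h1
      · exact Or.inr ⟨h1, h⟩
    · rintro (h | h)
      · linarith
      · exact h.2
  have hdisj : Disjoint (closedBall (0 : ℂ) (1 / 8)) {z : ℂ | ‖z‖ ∈ Set.Ioo (1 / 8 : ℝ) (7 / 10)} :=
    Set.disjoint_left.mpr fun z hz hz' =>
      (mem_closedBall_zero_iff.mp hz).not_gt hz'.1
  have hball : ∫ z in ball (0 : ℂ) (7 / 10), ‖deriv G z‖ ^ 2 ≤ π * (2 * M + M ^ 2 / 32 + 100 / 49) := by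
    rw [hunion, setIntegral_union hdisj (measurable_norm measurableSet_Ioo)
      (hintc.mono_set (closedBall_subset_closedBall (by norm_num)))
      (hintc.mono_set fun z hz => mem_closedBall_zero_iff.mpr hz.2.le)]
    have h1 : ∫ z in closedBall (0 : ℂ) (1 / 8), ‖deriv G z‖ ^ 2 ≤ π * (1 / 8) ^ 2 * M ^ 2 := by
      have h2 : ∫ z in closedBall (0 : ℂ) (1 / 8), ‖deriv G z‖ ^ 2 ≤
          ∫ _ in closedBall (0 : ℂ) (1 / 8), M ^ 2 :=
        setIntegral_mono_on (hintc.mono_set (closedBall_subset_closedBall (by norm_num)))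
          (integrableOn_const measure_closedBall_lt_top.ne) measurableSet_closedBall
          fun z hz => pow_le_pow_left₀ (norm_nonneg _) (hM z hz) 2
      refine h2.trans (le_of_eq ?_)
      rw [setIntegral_const, measureReal_def, Complex.volume_closedBall, smul_eq_mul]
      congr 1
      simp [mul_comm]
    nlinarith [pi_pos]
  have hw₀' : ‖w₀‖ ≤ 1 / 8 := mem_closedBall_zero_iff.mp hw₀
  have h1 := (mul_norm_sq_le_setIntegral (w := w₀) (δ := 23 / 40) (R := 3 / 4) (by norm_num)
    (by norm_num) (by linarith) hG').trans hball
  have h2 := (mul_norm_sq_le_setIntegral (w := w) (δ := 9 / 20) (R := 3 / 4) (by norm_num)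
    (by norm_num) (by linarith) hG').trans hball
  rw [mul_assoc] at h1 h2
  replace h1 := le_of_mul_le_mul_left h1 pi_pos
  replace h2 := le_of_mul_le_mul_left h2 pi_pos
  rw [← hMdef] at h1
  have hM8 : M ≤ 8 := by nlinarith
  nlinarith [norm_nonneg (deriv G w)]

/-! ### The class `𝒮` -/

/-- Only the disk `|ζ - z| < 3/4` about `z` is used. There `f'(z) / (f(ζ) - f(z))` has the form
`1 / w + G(w)` with `w = ζ - z`, and at `ζ = 0` one finds `D = 2 (1 - z (G(-z) - G(0)))`. -/
lemma re_D_pos_of_classS {f : ℂ → ℂ} (hf : ClassS f) {z : ℂ} (hz : ‖z‖ < 1 / 4) :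
    (z ≠ 0 → f z ≠ 0) ∧ deriv f z ≠ 0 ∧ 0 < (D f z).re := by
  obtain ⟨hA, hinj⟩ := hf
  have hzb : z ∈ ball (0 : ℂ) 1 := mem_ball_zero_iff.mpr (by linarith)
  have hfz : z ≠ 0 → f z ≠ 0 := fun h0 h =>
    h0 (hinj hzb (mem_ball_self one_pos) (by rw [h, hA.2.1]))
  have hd : deriv f z ≠ 0 := deriv_ne_zero_of_injOn isOpen_ball
    (convex_ball (0 : ℂ) 1).isPreconnected hA.differentiableOn hinj hzb
  refine ⟨hfz, hd, ?_⟩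
  rcases eq_or_ne z 0 with rfl | hz0
  · simp [D, logQuot]
  let κ : ℂ → ℂ := dslope f z
  have hκd : DifferentiableOn ℂ κ (ball 0 1) :=
    (Complex.differentiableOn_dslope (isOpen_ball.mem_nhds hzb)).mpr hA.differentiableOn
  have hκ : ∀ ζ, f ζ = f z + (ζ - z) * κ ζ := fun ζ => by
    have := sub_smul_dslope f z ζ
    rw [smul_eq_mul] at this
    rw [show κ ζ = dslope f z ζ from rfl, this]
    ring
  have hκz : κ z = deriv f z := dslope_same f z
  have hκne : ∀ ζ ∈ ball (0 : ℂ) 1, κ ζ ≠ 0 := fun ζ hζ h => by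
    rcases eq_or_ne ζ z with rfl | hne
    · exact hd (hκz ▸ h)
    · exact hne (hinj hζ hzb (by rw [hκ ζ, h, mul_zero, add_zero]))
  have hf'' : deriv (deriv f) z = 2 * deriv κ z := by
    have h1 : deriv f =ᶠ[nhds z] fun ζ => κ ζ + (ζ - z) * deriv κ ζ := by
      refine Filter.eventuallyEq_of_mem (isOpen_ball.mem_nhds hzb) fun ζ hζ => ?_
      have h2 := (((hasDerivAt_id ζ).sub_const z).mul
        (hκd.differentiableAt (isOpen_ball.mem_nhds hζ)).hasDerivAt).const_add (f z)
      have h3 : f = fun ζ => f z + (ζ - z) * κ ζ := funext hκ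
      conv_lhs => rw [h3]
      exact (h2.congr_deriv (by simp)).deriv
    rw [h1.deriv_eq]
    have h4 := (hκd.differentiableAt (isOpen_ball.mem_nhds hzb)).hasDerivAt
    have h5 := ((hκd.deriv isOpen_ball).differentiableAt (isOpen_ball.mem_nhds hzb)).hasDerivAt
    exact ((h4.add (((hasDerivAt_id z).sub_const z).mul h5)).congr_deriv (by simp; ring)).deriv
  let G : ℂ → ℂ := fun w => -(dslope κ z (z + w) / κ (z + w))
  have hmaps : Set.MapsTo (fun w => z + w) (ball (0 : ℂ) (3 / 4)) (ball 0 1) := fun w hw => by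
    rw [mem_ball_zero_iff] at hw ⊢
    linarith [norm_add_le z w]
  have hG : DifferentiableOn ℂ G (ball 0 (3 / 4)) := by
    have h1 : DifferentiableOn ℂ (fun ζ => dslope κ z ζ / κ ζ) (ball 0 1) :=
      ((Complex.differentiableOn_dslope (isOpen_ball.mem_nhds hzb)).mpr hκd).div hκd hκne
    exact (h1.comp (by fun_prop) hmaps).neg
  have hφ : ∀ w ∈ ball (0 : ℂ) (3 / 4), w ≠ 0 →
      w⁻¹ + G w = deriv f z / (f (z + w) - f z) := fun w hw hw0 => by
    have h1 := hκne _ (hmaps hw)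
    have h2 := sub_smul_dslope κ z (z + w)
    simp only [add_sub_cancel_left, smul_eq_mul] at h2
    rw [hκ (z + w), ← hκz]
    simp only [G, add_sub_cancel_left]
    field_simp
    linear_combination -h2
  have hGinj : Set.InjOn (fun w => w⁻¹ + G w) (ball 0 (3 / 4) \ {0}) := by
    rintro w ⟨hw, hw0⟩ w' ⟨hw', hw0'⟩ h
    simp only [hφ w hw hw0, hφ w' hw' hw0'] at h
    have h1 := div_div_cancel₀ (b := f (z + w) - f z) hd
    rw [h, div_div_cancel₀ hd] at h1
    exact (add_left_cancel (hinj (hmaps hw) (hmaps hw') (sub_left_injective h1.symm)))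
  have hnz : -z ∈ ball (0 : ℂ) (3 / 4) := by
    rw [mem_ball_zero_iff, norm_neg]; linarith
  have hosc : ‖G (-z) - G 0‖ ≤ 10 * ‖z‖ := by
    have := (convex_closedBall (0 : ℂ) (1 / 4)).norm_image_sub_le_of_norm_deriv_le (f := G)
      (fun y hy => hG.differentiableAt (isOpen_ball.mem_nhds
        (closedBall_subset_ball (by norm_num) hy)))
      (fun y hy => norm_deriv_le_of_injOn hG hGinj (mem_closedBall_zero_iff.mp hy))
      (mem_closedBall_self (by norm_num)) (y := -z) (by simpa using hz.le)
    simpa using this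
  have hD : D f z = 2 * (1 - z * (G (-z) - G 0)) := by
    have h1 := hφ (-z) hnz (neg_ne_zero.mpr hz0)
    rw [add_neg_cancel, hA.2.1, zero_sub] at h1
    have h2 : G 0 = -(deriv κ z / deriv f z) := by simp [G, hκz]
    have h3 : G (-z) = z⁻¹ - deriv f z / f z := by
      rw [inv_neg, div_neg] at h1
      linear_combination h1
    have := hfz hz0
    rw [h2, h3, D, logQuot, if_neg hz0, hf'']
    field_simp
    ring
  rw [hD, show (2 : ℂ) = ((2 : ℝ) : ℂ) by simp, Complex.re_ofReal_mul]
  refine mul_pos two_pos ?_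
  rw [Complex.sub_re, Complex.one_re, sub_pos]
  refine (Complex.re_le_norm _).trans_lt ?_
  rw [norm_mul]
  nlinarith [norm_nonneg z, mul_le_mul_of_nonneg_left hosc (norm_nonneg z)]

end Univ

/-! ### The radii -/

theorem theorem1 :
    (∃ r₁ : ℝ, (∀ r : ℝ, r ^ 3 + 2 * r ^ 2 - 2 = 0 ↔ r = r₁) ∧
      0.839 ≤ r₁ ∧ r₁ < 0.840 ∧
      ∀ f : ℂ → ℂ, Univ.ClassU f → Univ.RePosOn f r₁) ∧
    (∀ f : ℂ → ℂ, Univ.ClassStarOrder (1 / 2) f →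
      Univ.RePosOn f (Real.sqrt ((Real.sqrt 5 - 1) / 2))) ∧
    (∀ f : ℂ → ℂ, Univ.ClassG f → Univ.RePosOn f (2 / 3)) ∧
    (∀ f : ℂ → ℂ, Univ.ClassStar f → Univ.RePosOn f (1 / 2)) ∧
    (∀ f : ℂ → ℂ, Univ.ClassS f → Univ.RePosOn f (1 / 4)) := by
  refine ⟨?_, ?_, fun f hf z hz => Univ.re_D_pos_of_classG hf hz,
    fun f hf z hz => Univ.re_D_pos_of_classStar hf (by nlinarith [norm_nonneg z]),
    fun f hf z hz => Univ.re_D_pos_of_classS hf hz⟩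
  · have hcont : ContinuousOn (fun r : ℝ => r ^ 3 + 2 * r ^ 2 - 2) (Set.Icc 0.839 0.84) := by
      fun_prop
    obtain ⟨r₁, hr, hroot⟩ := intermediate_value_Icc (by norm_num) hcont
      (show (0 : ℝ) ∈ Set.Icc _ _ by constructor <;> norm_num)
    simp only at hroot
    refine ⟨r₁, fun r => ⟨fun h => ?_, fun h => h ▸ hroot⟩, hr.1, ?_, ?_⟩
    · -- the cofactor of `r - r₁` is a quadratic polynomial with negative discriminant
      have h1 : (r - r₁) * (r ^ 2 + (2 + r₁) * r + r₁ * (2 + r₁)) = 0 := by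
        linear_combination h - hroot
      have h2 : 0 < r ^ 2 + (2 + r₁) * r + r₁ * (2 + r₁) := by
        nlinarith [sq_nonneg (2 * r + (2 + r₁)), hr.1, hr.2]
      linarith [(mul_eq_zero.mp h1).resolve_right h2.ne']
    · refine lt_of_le_of_ne (hr.2.trans (by norm_num)) ?_
      rintro rfl
      norm_num at hroot
    · intro f hf z hz
      have h0 := norm_nonneg z
      have h3 : ‖z‖ ^ 3 < r₁ ^ 3 := pow_lt_pow_left₀ hz h0 (by norm_num)
      have h2 : ‖z‖ ^ 2 < r₁ ^ 2 := pow_lt_pow_left₀ hz h0 (by norm_num)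
      exact Univ.re_D_pos_of_classU hf (by linarith [hr.2]) (by linarith)
  · intro f hf z hz
    have h5 : Real.sqrt 5 ^ 2 = 5 := Real.sq_sqrt (by norm_num)
    have h1 : ‖z‖ ^ 2 < (Real.sqrt 5 - 1) / 2 := (Real.lt_sqrt (norm_nonneg z)).mp hz
    refine Univ.re_D_pos_of_classStarOrder_half hf ?_
    nlinarith [sq_nonneg ‖z‖, Real.sqrt_nonneg 5]
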